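/- All logarithms are to base $2$, $H(x)=-x\log x-(1-x)\log(1-x)$ is the binary entropy function (with $0\log 0=0$), and $m_\ell(G)$ denotes the number of matchings of $G$ with exactly $\ell$ edges. (i) Let $G$ be a $d$-regular graph on $N$ vertices, let $\ell$ be an integer with $0\le \ell\le N/2$, and put $\alpha=2\ell/N$. Then \[ \log m_\ell(G)\ \le\ \frac N2\bigl[\alpha\log d+H(\alpha)\bigr]. \] (ii) For every $\alpha\in(0,1)$ there is a constant $C_\alpha>0$, depending only on $\alpha$, such that for all integers $d\ge 2$, $N\ge 1$ and $\ell$ with $2d\mid N$ and $2\ell/N=\alpha$, the graph $DK_{N,d}$ consisting of $N/(2d)$ disjoint copies of the complete bipartite graph $K_{d,d}$ satisfies \[ \log m_\ell(DK_{N,d})\ \ge\ \frac N2\Bigl[\alpha\log d+2H(\alpha)+\alpha\log\Bigl(\frac{\alpha}{e}\Bigr)-C_\alpha\,\frac{\log d}{d}\Bigr]. \] (iii) Consequently the upper bound in (i) is tight in its leading term: for every $\alpha\in(0,1)$ and $\varepsilon>0$ there is $d_0$ such that for all integers $d\ge d_0$, $N\ge1$ and $\ell$ with $2d\mid N$ and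 $2\ell/N=\alpha$, \[ \log m_\ell(DK_{N,d})\ \ge\ (1-\varepsilon)\,\frac N2\bigl[\alpha\log d+H(\alpha)\bigr]. \] -/

import Mathlib

/-- The number of matchings of size `ℓ` (that is, with exactly `ℓ` edges) in the graph `G`. -/
noncomputable def numMatchings {V : Type*} (G : SimpleGraph V) (ℓ : ℕ) : ℕ :=
  {M : G.Subgraph | M.IsMatching ∧ M.edgeSet.ncard = ℓ}.ncard

/-- The disjoint union of `k` copies of the graph `H`. -/
def disjointCopies {W : Type*} (k : ℕ) (H : SimpleGraph W) : SimpleGraph (Fin k × W) where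
  Adj p q := p.1 = q.1 ∧ H.Adj p.2 q.2
  symm := ⟨fun _ _ h => ⟨h.1.symm, h.2.symm⟩⟩
  loopless := ⟨fun p h => H.loopless.irrefl p.2 h.2⟩

/-- The disjoint union of `N / (2 d)` copies of the complete bipartite graph `K_{d,d}`
(a graph on `N` vertices when `d ≥ 1` and `2 d` divides `N`). -/
def copiesKdd (N d : ℕ) : SimpleGraph (Fin (N / (2 * d)) × (Fin d ⊕ Fin d)) :=
  disjointCopies (N / (2 * d)) (completeBipartiteGraph (Fin d) (Fin d))

/-- The binary entropy function, with logarithms to base `2`. -/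
noncomputable def binaryEntropy (x : ℝ) : ℝ :=
  -x * Real.logb 2 x - (1 - x) * Real.logb 2 (1 - x)

/-! Upper bound: let `P_S(t)` be the matching polynomial of `G[S]`. The core,
`sq_matchingPoly_le_prod`, is `P_S(t)² ≤ ∏_{w ∈ S} (1 + t·deg_S w)`, by induction on `S`: delete a
vertex, apply a weighted Cauchy–Schwarz inequality, and absorb the resulting sum into the degree
factors of its neighbours. For a `d`-regular graph this gives `(m_ℓ t^ℓ)² ≤ (1 + td)^N`, and the
best `t` produces the entropy.

Lower bound: spread the `ℓ` edges evenly over the copies of `K_{d,d}`, about `αd` in each. A copy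
has `C(d,a)·d!/(d-a)!` matchings with `a` edges, which Stirling's formula estimates up to `O(log
d)`. Both bounds have leading term `α log d`, whence the tightness. -/

/-! ### The matching polynomial and the degree-product bound. -/

/-- The edge sets of the matchings of `G` all of whose vertices lie in `S`. -/
noncomputable def edgeMatchings {V : Type*} [Fintype V] (G : SimpleGraph V) (S : Finset V) :
    Finset (Finset (Sym2 V)) :=
  open Classical in
  Finset.univ.filter fun E =>
    (∀ e ∈ E, e ∈ G.edgeSet ∧ ∀ x ∈ e, x ∈ S) ∧ ∀ e ∈ E, ∀ e' ∈ E, ∀ x ∈ e, x ∈ e' → e = e'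

/-- The matching generating polynomial of the subgraph of `G` induced on `S`. -/
noncomputable def matchingPoly {V : Type*} [Fintype V] (G : SimpleGraph V) (S : Finset V)
    (t : ℝ) : ℝ :=
  ∑ E ∈ edgeMatchings G S, t ^ E.card

lemma mem_edgeMatchings {V : Type*} [Fintype V] {G : SimpleGraph V} {S : Finset V}
    {E : Finset (Sym2 V)} : E ∈ edgeMatchings G S ↔
      (∀ e ∈ E, e ∈ G.edgeSet ∧ ∀ x ∈ e, x ∈ S) ∧
        ∀ e ∈ E, ∀ e' ∈ E, ∀ x ∈ e, x ∈ e' → e = e' := by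
  simp [edgeMatchings]

lemma matchingPoly_nonneg {V : Type*} [Fintype V] (G : SimpleGraph V) (S : Finset V)
    {t : ℝ} (ht : 0 ≤ t) : 0 ≤ matchingPoly G S t :=
  Finset.sum_nonneg fun _ _ => pow_nonneg ht _

-- A matching either avoids `v` or contains an edge `vu`, whose removal leaves a matching avoiding
-- both ends.
open Classical in
lemma matchingPoly_le_erase_add_sum {V : Type*} [Fintype V] (G : SimpleGraph V)
    (S : Finset V) {v : V} {t : ℝ} (ht : 0 ≤ t) :
    matchingPoly G S t ≤ matchingPoly G (S.erase v) t +
      ∑ u ∈ S.filter (G.Adj v), t * matchingPoly G ((S.erase v).erase u) t := by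
  have key : ∀ u ∈ S.filter (G.Adj v),
      ∑ E ∈ (edgeMatchings G S).filter (fun E => s(v, u) ∈ E), t ^ E.card ≤
        t * matchingPoly G ((S.erase v).erase u) t := by
    intro u hu
    have h1 : ∑ E ∈ (edgeMatchings G S).filter (fun E => s(v, u) ∈ E), t ^ E.card =
        ∑ E ∈ ((edgeMatchings G S).filter (fun E => s(v, u) ∈ E)).image
          (fun E => E.erase s(v, u)), t * t ^ E.card := by
      rw [Finset.sum_image]
      · refine Finset.sum_congr rfl fun E hE => ?_
        have hE' := (Finset.mem_filter.1 hE).2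
        rw [← pow_succ', Finset.card_erase_add_one hE']
      · intro E hE E' hE' h
        have a := (Finset.mem_filter.1 hE).2
        have b := (Finset.mem_filter.1 hE').2
        simp only at h
        rw [← Finset.insert_erase a, h, Finset.insert_erase b]
    rw [h1, matchingPoly, Finset.mul_sum]
    refine Finset.sum_le_sum_of_subset_of_nonneg ?_ fun _ _ _ => mul_nonneg ht (pow_nonneg ht _)
    intro F hF
    obtain ⟨E, hE, rfl⟩ := Finset.mem_image.1 hF
    obtain ⟨hE, he⟩ := Finset.mem_filter.1 hE
    rw [mem_edgeMatchings] at hE ⊢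
    refine ⟨fun e h => ?_, fun e h e' h' => hE.2 e (Finset.mem_of_mem_erase h) e'
      (Finset.mem_of_mem_erase h')⟩
    obtain ⟨hne, h⟩ := Finset.mem_erase.1 h
    refine ⟨(hE.1 e h).1, fun x hx => ?_⟩
    refine Finset.mem_erase.2 ⟨?_, Finset.mem_erase.2 ⟨?_, (hE.1 e h).2 x hx⟩⟩
    · intro hx'
      exact hne (hE.2 e h _ he x hx (by simp [hx']))
    · intro hx'
      exact hne (hE.2 e h _ he x hx (by simp [hx']))
  have hsplit : matchingPoly G S t =
      ∑ E ∈ (edgeMatchings G S).filter (fun E => ∀ e ∈ E, v ∉ e), t ^ E.card +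
      ∑ E ∈ (edgeMatchings G S).filter (fun E => ¬ ∀ e ∈ E, v ∉ e), t ^ E.card :=
    (Finset.sum_filter_add_sum_filter_not _ _ _).symm
  rw [hsplit]
  refine add_le_add ?_ (le_trans ?_ (Finset.sum_le_sum key))
  · refine Finset.sum_le_sum_of_subset_of_nonneg ?_ fun _ _ _ => pow_nonneg ht _
    intro E hE
    obtain ⟨hE, he⟩ := Finset.mem_filter.1 hE
    rw [mem_edgeMatchings] at hE ⊢
    refine ⟨fun e h => ⟨(hE.1 e h).1, fun x hx => Finset.mem_erase.2 ⟨?_, (hE.1 e h).2 x hx⟩⟩, hE.2⟩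
    rintro rfl
    exact he e h hx
  · simp_rw [Finset.sum_filter (s := edgeMatchings G S)]
    rw [Finset.sum_comm]
    refine Finset.sum_le_sum fun E hE => ?_
    split_ifs with h
    · exact Finset.sum_nonneg fun _ _ => by split_ifs <;> positivity
    · push Not at h
      obtain ⟨e, he, hv⟩ := h
      obtain ⟨u, rfl⟩ := hv
      rw [mem_edgeMatchings] at hE
      have hu : u ∈ S.filter (G.Adj v) :=
        Finset.mem_filter.2 ⟨(hE.1 _ he).2 u (by simp), (hE.1 _ he).1⟩
      refine le_trans ?_ (Finset.single_le_sum (f := fun u => if s(v, u) ∈ E then t ^ E.card else 0)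
        (fun _ _ => by split_ifs <;> positivity) hu)
      simp [he]

lemma one_add_sum_le_prod_one_add {ι : Type*} (s : Finset ι) (f : ι → ℝ)
    (hf : ∀ i ∈ s, 0 ≤ f i) : 1 + ∑ i ∈ s, f i ≤ ∏ i ∈ s, (1 + f i) := by
  classical
  induction s using Finset.induction_on with
  | empty => simp
  | insert a s ha ih =>
    rw [Finset.sum_insert ha, Finset.prod_insert ha]
    have h1 := ih fun i hi => hf i (Finset.mem_insert_of_mem hi)
    have h2 := hf a (Finset.mem_insert_self a s)
    have h3 : 0 ≤ ∑ i ∈ s, f i :=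
      Finset.sum_nonneg fun i hi => hf i (Finset.mem_insert_of_mem hi)
    nlinarith

/-- Cauchy–Schwarz with weights `1, t, …, t`: the right side minus the left is `t ∑ (x - y i)² + t²
(|s| ∑ y i² - (∑ y i)²)`. -/
lemma sq_add_mul_sum_le {ι : Type*} (s : Finset ι) (x t : ℝ) (y : ι → ℝ) (ht : 0 ≤ t) :
    (x + ∑ i ∈ s, t * y i) ^ 2 ≤ (1 + t * s.card) * (x ^ 2 + t * ∑ i ∈ s, y i ^ 2) := by
  rw [← Finset.mul_sum]
  have h1 := sq_sum_le_card_mul_sum_sq (s := s) (f := y)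
  have h2 : 0 ≤ ∑ i ∈ s, (x - y i) ^ 2 := Finset.sum_nonneg fun _ _ => sq_nonneg _
  have h3 : ∑ i ∈ s, (x - y i) ^ 2 =
      s.card * x ^ 2 - 2 * x * ∑ i ∈ s, y i + ∑ i ∈ s, y i ^ 2 := by
    simp_rw [sub_sq]
    rw [Finset.sum_add_distrib, Finset.sum_sub_distrib, ← Finset.mul_sum]
    simp
  rw [h3] at h2
  nlinarith [mul_le_mul_of_nonneg_left h1 (sq_nonneg t), mul_nonneg ht h2]

open Classical in
/-- The square of the matching polynomial is at most the generating function of the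
partial maps that move every vertex of their domain along an edge. -/
theorem sq_matchingPoly_le_prod {V : Type*} [Fintype V] (G : SimpleGraph V) {t : ℝ}
    (ht : 0 ≤ t) (S : Finset V) :
    matchingPoly G S t ^ 2 ≤ ∏ w ∈ S, (1 + t * (S.filter (G.Adj w)).card) := by
  induction S using Finset.strongInduction with
  | H S ih =>
    obtain rfl | ⟨v, hv⟩ := S.eq_empty_or_nonempty
    · have : edgeMatchings G (∅ : Finset V) = {∅} := by
        ext E
        rw [mem_edgeMatchings, Finset.mem_singleton]
        refine ⟨fun h => Finset.eq_empty_of_forall_notMem fun e he => ?_, ?_⟩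
        · induction e with
          | h x y => simpa using (h.1 _ he).2 x (by simp)
        · rintro rfl
          simp
      simp [matchingPoly, this]
    set T := S.erase v with hT
    set b : V → ℝ := fun w => 1 + t * (T.filter (G.Adj w)).card with hb
    have hb1 : ∀ w, 1 ≤ b w := fun w => le_add_of_nonneg_right (by positivity)
    have hB : 0 ≤ ∏ w ∈ T, b w := Finset.prod_nonneg fun w _ => by linarith [hb1 w]
    set N := S.filter (G.Adj v) with hN
    have hNT : N ⊆ T := fun u hu => by
      obtain ⟨h1, h2⟩ := Finset.mem_filter.1 hu
      exact Finset.mem_erase.2 ⟨h2.ne', h1⟩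
    have hTS : T ⊂ S := Finset.erase_ssubset hv
    have h1 : matchingPoly G T t ^ 2 ≤ ∏ w ∈ T, b w := ih T hTS
    -- Removing `u` drops its factor `b u` and can only lower the other degrees.
    have h2 : ∀ u ∈ N, matchingPoly G (T.erase u) t ^ 2 ≤ (∏ w ∈ T, b w) * (1 / b u) := by
      intro u hu
      rw [← Finset.prod_erase_mul T b (hNT hu), mul_assoc,
        mul_one_div_cancel (by linarith [hb1 u]), mul_one]
      refine (ih _ ((Finset.erase_subset _ _).trans_ssubset hTS)).trans ?_
      refine Finset.prod_le_prod (fun _ _ => by positivity) fun w _ => ?_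
      simp only [hb]
      gcongr
      exact Finset.erase_subset _ _
    -- Restoring `v` raises the degree of each neighbour `u` by one: `b u + t = b u * (1 + t / b
    -- u)`.
    have h3 : ∏ w ∈ T, (1 + t * ((S.filter (G.Adj w)).card : ℝ)) =
        (∏ w ∈ T, b w) * ∏ u ∈ N, (1 + t * (1 / b u)) := by
      have h4 : ∏ u ∈ N, (1 + t * (1 / b u)) =
          ∏ u ∈ T, if u ∈ N then 1 + t * (1 / b u) else 1 := by
        rw [Finset.prod_ite_mem, Finset.inter_eq_right.2 hNT]
      rw [h4, ← Finset.prod_mul_distrib]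
      refine Finset.prod_congr rfl fun w hw => ?_
      have hSv : S = insert v T := (Finset.insert_erase hv).symm
      have hwS := Finset.mem_of_mem_erase hw
      by_cases hvw : G.Adj v w
      · have hwN : w ∈ N := Finset.mem_filter.2 ⟨hwS, hvw⟩
        have hb0 : b w ≠ 0 := by linarith [hb1 w]
        rw [if_pos hwN, mul_add, mul_one, mul_left_comm, mul_one_div_cancel hb0, hSv,
          Finset.filter_insert, if_pos hvw.symm, Finset.card_insert_of_notMem (by simp [hT])]
        simp only [hb]
        push_cast
        ring
      · have hwN : w ∉ N := fun h => hvw (Finset.mem_filter.1 h).2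
        rw [if_neg hwN, mul_one, hSv, Finset.filter_insert, if_neg fun h => hvw h.symm]
    have h5 : ∑ u ∈ N, matchingPoly G (T.erase u) t ^ 2 ≤
        (∏ w ∈ T, b w) * ∑ u ∈ N, 1 / b u := by
      rw [Finset.mul_sum]
      exact Finset.sum_le_sum h2
    have h6 : 1 + t * ∑ u ∈ N, 1 / b u ≤ ∏ u ∈ N, (1 + t * (1 / b u)) := by
      rw [Finset.mul_sum]
      exact one_add_sum_le_prod_one_add _ _ fun u _ =>
        mul_nonneg ht (one_div_nonneg.2 (by linarith [hb1 u]))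
    have hN0 : 0 ≤ 1 + t * (N.card : ℝ) := by positivity
    calc matchingPoly G S t ^ 2
        ≤ (matchingPoly G T t + ∑ u ∈ N, t * matchingPoly G (T.erase u) t) ^ 2 :=
          pow_le_pow_left₀ (matchingPoly_nonneg _ _ ht) (matchingPoly_le_erase_add_sum G S ht) 2
      _ ≤ (1 + t * N.card) *
            (matchingPoly G T t ^ 2 + t * ∑ u ∈ N, matchingPoly G (T.erase u) t ^ 2) :=
          sq_add_mul_sum_le _ _ _ _ ht
      _ ≤ (1 + t * N.card) * ((∏ w ∈ T, b w) * (1 + t * ∑ u ∈ N, 1 / b u)) := by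
          refine mul_le_mul_of_nonneg_left ?_ hN0
          linarith [mul_le_mul_of_nonneg_left h5 ht]
      _ ≤ (1 + t * N.card) * ((∏ w ∈ T, b w) * ∏ u ∈ N, (1 + t * (1 / b u))) :=
          mul_le_mul_of_nonneg_left (mul_le_mul_of_nonneg_left h6 hB) hN0
      _ = ∏ w ∈ S, (1 + t * ((S.filter (G.Adj w)).card : ℝ)) := by
          rw [← h3, ← Finset.mul_prod_erase S _ hv]

lemma numMatchings_mul_pow_le {V : Type*} [Fintype V] (G : SimpleGraph V) (ℓ : ℕ) {t : ℝ}
    (ht : 0 ≤ t) : numMatchings G ℓ * t ^ ℓ ≤ matchingPoly G Finset.univ t := by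
  classical
  have hsub : (fun M : G.Subgraph => M.edgeSet) ''
      {M : G.Subgraph | M.IsMatching ∧ M.edgeSet.ncard = ℓ} ⊆
      (fun E : Finset (Sym2 V) => (E : Set (Sym2 V))) ''
        ((edgeMatchings G Finset.univ).filter fun E => E.card = ℓ : Finset _) := by
    rintro _ ⟨M, ⟨hM, hc⟩, rfl⟩
    refine ⟨M.edgeSet.toFinset, ?_, by simp⟩
    simp only [Finset.coe_filter, Set.mem_ofPred_eq, mem_edgeMatchings, Set.mem_toFinset]
    refine ⟨⟨fun e he => ⟨M.edgeSet_subset he, by simp⟩, ?_⟩, ?_⟩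
    · intro e he e' he' x hx hx'
      obtain ⟨y, rfl⟩ := hx
      obtain ⟨z, rfl⟩ := hx'
      have hyz : y = z := hM.eq_of_adj_left he he'
      rw [hyz]
    · rw [← hc, Set.ncard_eq_toFinset_card']
  have hle : numMatchings G ℓ ≤ ((edgeMatchings G Finset.univ).filter fun E => E.card = ℓ).card := by
    -- A matching is determined by its edge set, so passing to edge sets loses nothing.
    rw [numMatchings, ← Set.InjOn.ncard_image (f := fun M : G.Subgraph => M.edgeSet)
      (fun M hM M' hM' h => SimpleGraph.Subgraph.IsMatching.injOn_edgeSet hM.1 hM'.1 h),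
      ← Set.ncard_coe_finset]
    exact (Set.ncard_le_ncard hsub (Set.toFinite _)).trans (Set.ncard_image_le (Set.toFinite _))
  calc (numMatchings G ℓ : ℝ) * t ^ ℓ
      ≤ ((edgeMatchings G Finset.univ).filter fun E => E.card = ℓ).card * t ^ ℓ := by gcongr
    _ = ∑ E ∈ (edgeMatchings G Finset.univ).filter (fun E => E.card = ℓ), t ^ E.card := by
        rw [← nsmul_eq_mul, ← Finset.sum_const]
        exact Finset.sum_congr rfl fun E hE => by rw [(Finset.mem_filter.1 hE).2]
    _ ≤ matchingPoly G Finset.univ t :=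
        Finset.sum_le_sum_of_subset_of_nonneg (Finset.filter_subset _ _)
          fun _ _ _ => pow_nonneg ht _

theorem sq_numMatchings_mul_pow_le {V : Type*} [Fintype V] (G : SimpleGraph V)
    [DecidableRel G.Adj] {d : ℕ} (hG : G.IsRegularOfDegree d) (ℓ : ℕ) {t : ℝ} (ht : 0 ≤ t) :
    ((numMatchings G ℓ : ℝ) * t ^ ℓ) ^ 2 ≤ (1 + t * d) ^ Fintype.card V := by
  classical
  refine (pow_le_pow_left₀ (by positivity) (numMatchings_mul_pow_le G ℓ ht) 2).trans
    ((sq_matchingPoly_le_prod G ht Finset.univ).trans_eq ?_)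
  rw [← Finset.card_univ, ← Finset.prod_const]
  refine Finset.prod_congr rfl fun w _ => ?_
  rw [← hG w, ← SimpleGraph.card_neighborFinset_eq_degree]
  congr 4
  ext u
  simp

/-! ### Entropy and the optimisation over `t`. -/

lemma binaryEntropy_eq (x : ℝ) :
    binaryEntropy x = (-x * Real.log x - (1 - x) * Real.log (1 - x)) / Real.log 2 := by
  simp only [binaryEntropy, Real.logb]
  ring

lemma binaryEntropy_nonneg {x : ℝ} (h0 : 0 ≤ x) (h1 : x ≤ 1) : 0 ≤ binaryEntropy x := by
  rw [binaryEntropy_eq]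
  refine div_nonneg ?_ (Real.log_nonneg (by norm_num))
  nlinarith [Real.log_nonpos h0 h1,
    Real.log_nonpos (sub_nonneg.2 h1) (sub_le_self 1 h0)]

lemma logb_two_natCast_nonneg (n : ℕ) : 0 ≤ Real.logb 2 n :=
  div_nonneg (Real.log_natCast_nonneg n) (Real.log_nonneg (by norm_num))

theorem logb_numMatchings_le {V : Type*} [Fintype V] (G : SimpleGraph V) [DecidableRel G.Adj]
    {d N ℓ : ℕ} {α : ℝ} (hG : G.IsRegularOfDegree d) (hN : Fintype.card V = N)
    (hℓ : 2 * ℓ ≤ N) (hα : α = 2 * (ℓ : ℝ) / (N : ℝ)) :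
    Real.logb 2 (numMatchings G ℓ) ≤
      (N : ℝ) / 2 * (α * Real.logb 2 d + binaryEntropy α) := by
  have hℓ' : 2 * (ℓ : ℝ) ≤ N := by exact_mod_cast hℓ
  have hα0 : 0 ≤ α := hα ▸ by positivity
  have hα1 : α ≤ 1 := hα ▸ div_le_one_of_le₀ hℓ' (by positivity)
  have hrhs : 0 ≤ (N : ℝ) / 2 * (α * Real.logb 2 d + binaryEntropy α) :=
    mul_nonneg (by positivity) (add_nonneg (mul_nonneg hα0 (logb_two_natCast_nonneg d))
      (binaryEntropy_nonneg hα0 hα1))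
  have key : ∀ t : ℝ, 0 ≤ t → ((numMatchings G ℓ : ℝ) * t ^ ℓ) ^ 2 ≤ (1 + t * d) ^ N :=
    fun t ht => hN ▸ sq_numMatchings_mul_pow_le G hG ℓ ht
  -- If there are no matchings, the convention `logb 2 0 = 0` leaves only nonnegativity of the right
  -- side.
  obtain hm | hm := Nat.eq_zero_or_pos (numMatchings G ℓ)
  · simpa [hm] using hrhs
  set m := numMatchings G ℓ with hm_def
  have hm1 : (1 : ℝ) ≤ m := by exact_mod_cast hm
  obtain rfl | hℓ0 := Nat.eq_zero_or_pos ℓ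
  · refine le_trans ?_ hrhs
    have h := key 0 le_rfl
    simp only [pow_zero, mul_one, zero_mul, add_zero, one_pow] at h
    exact Real.logb_nonpos one_lt_two (by positivity) (by nlinarith)
  have hN0 : (0 : ℝ) < N := by
    have : 0 < N := by omega
    exact_mod_cast this
  -- With `d = 0` and `ℓ > 0`, `t = 2` would force `m * 2 ^ ℓ ≤ 1`.
  have hd0 : (0 : ℝ) < d := by
    refine Nat.cast_pos.2 (Nat.pos_of_ne_zero ?_)
    rintro rfl
    have h := key 2 zero_le_two
    simp only [Nat.cast_zero, mul_zero, add_zero, one_pow] at h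
    have h2 : (2 : ℝ) ≤ 2 ^ ℓ := le_self_pow₀ one_le_two hℓ0.ne'
    have h3 : (2 : ℝ) ≤ m * 2 ^ ℓ := by nlinarith
    nlinarith
  have hL : 0 < Real.log 2 := Real.log_pos one_lt_two
  have hℓα : (ℓ : ℝ) = α * N / 2 := by rw [hα]; field_simp
  rw [binaryEntropy_eq, Real.logb, Real.logb]
  rw [show (N : ℝ) / 2 * (α * (Real.log d / Real.log 2) +
      (-α * Real.log α - (1 - α) * Real.log (1 - α)) / Real.log 2) =
      (N / 2 * (α * Real.log d + (-α * Real.log α - (1 - α) * Real.log (1 - α)))) / Real.log 2 by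
    ring]
  refine div_le_div_of_nonneg_right ?_ hL.le
  have hlog : ∀ t : ℝ, 0 < t →
      2 * (Real.log m + ℓ * Real.log t) ≤ N * Real.log (1 + t * d) := by
    intro t ht
    have h := Real.log_le_log (by positivity) (key t ht.le)
    rwa [Real.log_pow, Real.log_pow, Real.log_mul (by positivity) (by positivity),
      Real.log_pow] at h
  have hαpos : 0 < α := by rw [hα]; positivity
  obtain hlt | rfl := hα1.lt_or_eq
  · have h1 : 0 < 1 - α := sub_pos.2 hlt
    -- This `t` minimises `N log (1 + td) - 2ℓ log t`: it solves `td / (1 + td) = α`.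
    have h := hlog (α / ((1 - α) * d)) (by positivity)
    rw [show 1 + α / ((1 - α) * d) * d = (1 - α)⁻¹ by field_simp; ring, Real.log_inv,
      Real.log_div hαpos.ne' (by positivity), Real.log_mul h1.ne' hd0.ne', hℓα] at h
    nlinarith
  -- For `α = 1` the infimum is approached only as `t → ∞`, so put `t = s⁻¹` and let `s → 0⁺`.
  · have h : ∀ s : ℝ, 0 < s → Real.log m ≤ ℓ * Real.log (d + s) := by
      intro s hs
      have h := hlog s⁻¹ (by positivity)
      rw [show 1 + s⁻¹ * d = (d + s) / s by field_simp; ring,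
        Real.log_div (by positivity) hs.ne', Real.log_inv] at h
      rw [show (N : ℝ) = 2 * ℓ by rw [hℓα]; ring] at h
      linarith
    have hlim : Filter.Tendsto (fun s : ℝ => ℓ * Real.log (d + s))
        (nhdsWithin 0 (Set.Ioi 0)) (nhds (ℓ * Real.log (d + 0))) := by
      refine Filter.Tendsto.mono_left ?_ nhdsWithin_le_nhds
      refine ContinuousAt.tendsto (f := fun s : ℝ => ℓ * Real.log (d + s)) ?_
      exact continuousAt_const.mul
        ((continuousAt_const.add continuousAt_id).log (by simpa using hd0.ne'))
    have h2 := ge_of_tendsto hlim (eventually_nhdsWithin_of_forall h)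
    rw [add_zero, hℓα] at h2
    simp only [Real.log_one, sub_self, zero_mul, mul_zero, add_zero]
    linarith

/-! ### Stirling estimates and the count in one `K_{d,d}`. -/

lemma natCast_mul_log_sub_le_log_factorial (n : ℕ) :
    (n : ℝ) * Real.log n - n ≤ Real.log n.factorial := by
  obtain rfl | hn := Nat.eq_zero_or_pos n
  · simp
  have hn' : (0 : ℝ) < n := by exact_mod_cast hn
  have h := Real.log_le_log (by positivity)
    (Real.pow_div_factorial_le_exp (n : ℝ) n.cast_nonneg n)
  rw [Real.log_exp, Real.log_div (by positivity) (by positivity), Real.log_pow] at h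
  linarith

/-- The induction step amounts to `(n + 2) log ((n + 2) / (n + 1)) ≥ 1`. -/
lemma log_factorial_le (n : ℕ) :
    Real.log n.factorial ≤ ((n : ℝ) + 1) * Real.log (n + 1) - n := by
  induction n with
  | zero => simp
  | succ n ih =>
    rw [Nat.factorial_succ, Nat.cast_mul, Real.log_mul (by positivity) (by positivity)]
    push_cast
    have hn : (0 : ℝ) ≤ n := n.cast_nonneg
    have h := Real.one_sub_inv_le_log_of_pos
      (show (0 : ℝ) < (n + 1 + 1) / (n + 1) by positivity)
    rw [Real.log_div (by positivity) (by positivity), inv_div] at h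
    have h2 : ((n : ℝ) + 1 + 1) * (1 - (n + 1) / (n + 1 + 1)) = 1 := by
      field_simp
      ring
    nlinarith [mul_le_mul_of_nonneg_left h (show (0 : ℝ) ≤ n + 1 + 1 by positivity)]

/-- Stirling's upper bound, with `n` replaced by a real number close to it. -/
lemma log_factorial_le_of_abs_sub_le {a d : ℕ} {b : ℝ} (had : a ≤ d) (hb : 0 < b)
    (hab : |(a : ℝ) - b| ≤ 1) :
    Real.log a.factorial ≤ b * Real.log b - b + (2 * Real.log (d + 1) + 3) := by
  obtain ⟨h1, h2⟩ := abs_le.1 hab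
  have ha : (0 : ℝ) < a + 1 := by positivity
  have hlog : Real.log ((a : ℝ) + 1) ≤ Real.log (d + 1) :=
    Real.log_le_log ha (by gcongr)
  have hlog0 : 0 ≤ Real.log ((a : ℝ) + 1) := Real.log_nonneg (by linarith [a.cast_nonneg (α := ℝ)])
  have htan := Real.log_le_sub_one_of_pos (show 0 < ((a : ℝ) + 1) / b by positivity)
  rw [Real.log_div ha.ne' hb.ne'] at htan
  -- The tangent-line bound replaces `b log (a + 1)` by `b log b`; the remaining `(a + 1 - b) log (a
  -- + 1)` is at most `2 log (d + 1)`.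
  have h3 := mul_le_mul_of_nonneg_left htan hb.le
  rw [mul_sub, mul_sub, mul_div_cancel₀ _ hb.ne'] at h3
  have h4 := mul_le_mul_of_nonneg_right (show (a : ℝ) + 1 - b ≤ 2 by linarith) hlog0
  linarith [log_factorial_le a]

/-- A lower bound for the number of matchings with `a` edges in `K_{d,d}`, for `a` close to `α d`. -/
lemma le_log_choose_mul_descFactorial {a d : ℕ} {α : ℝ} (hd : 2 ≤ d) (had : a ≤ d)
    (hα0 : 0 < α) (hα1 : α < 1) (hab : |(a : ℝ) - α * d| ≤ 1) :
    d * (α * Real.log d - α * Real.log α - 2 * ((1 - α) * Real.log (1 - α)) - α)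
        - 30 * Real.log d ≤
      Real.log ((d.choose a * d.descFactorial a : ℕ) : ℝ) := by
  have hd0 : (0 : ℝ) < d := by positivity
  have hd2 : (2 : ℝ) ≤ d := by exact_mod_cast hd
  have hα1' : 0 < 1 - α := sub_pos.2 hα1
  have e1 : Real.log d.factorial = Real.log (d.choose a : ℝ) + Real.log a.factorial +
      Real.log (d - a).factorial := by
    have := Nat.choose_pos had
    rw [← Nat.choose_mul_factorial_mul_factorial had]
    push_cast
    rw [Real.log_mul (by positivity) (by positivity), Real.log_mul (by positivity) (by positivity)]
  have hdf : 0 < d.descFactorial a := Nat.descFactorial_pos.2 had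
  have e2 : Real.log d.factorial = Real.log (d - a).factorial +
      Real.log (d.descFactorial a : ℝ) := by
    rw [← Nat.factorial_mul_descFactorial had]
    push_cast
    rw [Real.log_mul (by positivity) (by positivity)]
  have hch : 0 < d.choose a := Nat.choose_pos had
  rw [Nat.cast_mul, Real.log_mul (by positivity) (by positivity)]
  -- The count is `d!² / (a! (d - a)!²)`: the lower bound enters twice, upper bounds three times.
  have s0 := natCast_mul_log_sub_le_log_factorial d
  have s1 := log_factorial_le_of_abs_sub_le had (mul_pos hα0 hd0) hab
  have s2 := log_factorial_le_of_abs_sub_le (a := d - a) (b := (1 - α) * d) (Nat.sub_le d a)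
    (mul_pos hα1' hd0) (by
      rw [Nat.cast_sub had, abs_sub_comm]
      convert hab using 2
      ring)
  rw [Real.log_mul hα0.ne' hd0.ne'] at s1
  rw [Real.log_mul hα1'.ne' hd0.ne'] at s2
  -- Each of the three errors `2 log (d + 1) + 3` is at most `(4 + 6) log d`, giving 30.
  have l1 : Real.log ((d : ℝ) + 1) ≤ 2 * Real.log d := by
    rw [← Nat.cast_two (R := ℝ), ← Real.log_pow]
    exact Real.log_le_log (by positivity) (by nlinarith)
  have l2 : 1 ≤ 2 * Real.log d := by
    have := Real.log_le_log zero_lt_two hd2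
    linarith [Real.log_two_gt_d9]
  nlinarith

/-! ### Encoding matchings of disjoint copies of `K_{d,d}`. -/

/-- The subgraph whose edges join every `x ∈ T` to `f x`. -/
def matchingSubgraph {V : Type*} (G : SimpleGraph V) (T : Set V) (f : V → V)
    (hG : ∀ x ∈ T, G.Adj x (f x)) : G.Subgraph where
  verts := T ∪ f '' T
  Adj p q := (p ∈ T ∧ q = f p) ∨ (q ∈ T ∧ p = f q)
  adj_sub := by
    rintro p q (⟨h, rfl⟩ | ⟨h, rfl⟩)
    · exact hG p h
    · exact (hG q h).symm
  edge_vert := by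
    rintro p q (⟨h, rfl⟩ | ⟨h, rfl⟩)
    · exact Or.inl h
    · exact Or.inr ⟨q, h, rfl⟩
  symm := ⟨fun _ _ h => h.symm⟩

lemma matchingSubgraph_isMatching {V : Type*} {G : SimpleGraph V} {T : Set V} {f : V → V}
    (hG : ∀ x ∈ T, G.Adj x (f x)) (hinj : Set.InjOn f T) (hT : ∀ x ∈ T, f x ∉ T) :
    (matchingSubgraph G T f hG).IsMatching := by
  rintro v (hv | ⟨u, hu, rfl⟩)
  · refine ⟨f v, Or.inl ⟨hv, rfl⟩, ?_⟩
    rintro w (⟨_, rfl⟩ | ⟨hw, rfl⟩)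
    · rfl
    · exact absurd hv (hT w hw)
  · refine ⟨u, Or.inr ⟨hu, rfl⟩, ?_⟩
    rintro w (⟨h, rfl⟩ | ⟨hw, h⟩)
    · exact absurd h (hT u hu)
    · exact (hinj hu hw h).symm

/-- As `f x ∉ T`, each edge has exactly one end in `T`. -/
lemma ncard_edgeSet_matchingSubgraph {V : Type*} {G : SimpleGraph V} {T : Set V} {f : V → V}
    (hG : ∀ x ∈ T, G.Adj x (f x)) (hT : ∀ x ∈ T, f x ∉ T) :
    (matchingSubgraph G T f hG).edgeSet.ncard = T.ncard := by
  have h : (matchingSubgraph G T f hG).edgeSet = (fun x => s(x, f x)) '' T := by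
    ext e
    induction e with
    | h p q =>
      rw [SimpleGraph.Subgraph.mem_edgeSet]
      constructor
      · rintro (⟨h, rfl⟩ | ⟨h, rfl⟩)
        · exact ⟨p, h, rfl⟩
        · exact ⟨q, h, Sym2.eq_swap⟩
      · rintro ⟨x, hx, h⟩
        rcases Sym2.eq_iff.1 h with ⟨rfl, rfl⟩ | ⟨rfl, rfl⟩
        · exact Or.inl ⟨hx, rfl⟩
        · exact Or.inr ⟨hx, rfl⟩
  rw [h]
  refine Set.InjOn.ncard_image fun x hx y hy hxy => ?_
  rcases Sym2.eq_iff.1 hxy with ⟨h, _⟩ | ⟨h, _⟩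
  · exact h
  · exact absurd (h ▸ hx) (hT y hy)

/-- A choice, for every index `i`, of an `a i`-element subset of `Fin d` and an injection of
this subset into `Fin d`. -/
abbrev PartialInjections (k d : ℕ) (a : Fin k → ℕ) : Type :=
  (i : Fin k) → (A : {A : Finset (Fin d) // A.card = a i}) × (A.1 ↪ Fin d)

lemma card_partialInjections (k d : ℕ) (a : Fin k → ℕ) :
    Nat.card (PartialInjections k d a) = ∏ i, d.choose (a i) * d.descFactorial (a i) := by
  rw [Nat.card_eq_fintype_card, Fintype.card_pi]
  refine Finset.prod_congr rfl fun i _ => ?_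
  rw [Fintype.card_sigma]
  have : ∀ A : {A : Finset (Fin d) // A.card = a i},
      Fintype.card (A.1 ↪ Fin d) = d.descFactorial (a i) := fun A => by
    rw [Fintype.card_embedding_eq, Fintype.card_fin, Fintype.card_coe, A.2]
  simp_rw [this]
  rw [Finset.sum_const, Finset.card_univ, Fintype.card_finset_len, Fintype.card_fin, smul_eq_mul]

namespace PartialInjections

variable {k d : ℕ} {a : Fin k → ℕ} (c : PartialInjections k d a)

/-- The left endpoints of the edges encoded by `c`. -/
def domain : Set (Fin k × (Fin d ⊕ Fin d)) :=
  {p | ∃ x ∈ (c p.1).1.1, p.2 = Sum.inl x}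

/-- The map that sends a left endpoint to the right endpoint of its edge. -/
def toFun (p : Fin k × (Fin d ⊕ Fin d)) : Fin k × (Fin d ⊕ Fin d) :=
  -- Values off the domain are irrelevant; they only make the map total.
  (p.1, Sum.elim (fun x => if h : x ∈ (c p.1).1.1 then Sum.inr ((c p.1).2 ⟨x, h⟩) else Sum.inl x)
    Sum.inr p.2)

lemma toFun_inl {i : Fin k} {x : Fin d} (h : x ∈ (c i).1.1) :
    c.toFun (i, Sum.inl x) = (i, Sum.inr ((c i).2 ⟨x, h⟩)) := by
  simp [toFun, h]

lemma mem_domain {i : Fin k} {x : Fin d} : (i, Sum.inl x) ∈ c.domain ↔ x ∈ (c i).1.1 := by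
  simp [domain]

lemma exists_of_mem_domain {p : Fin k × (Fin d ⊕ Fin d)} (hp : p ∈ c.domain) :
    ∃ i x, x ∈ (c i).1.1 ∧ p = (i, Sum.inl x) := by
  obtain ⟨i, y⟩ := p
  obtain ⟨x, hx, rfl⟩ := hp
  exact ⟨i, x, hx, rfl⟩

lemma toFun_adj {p : Fin k × (Fin d ⊕ Fin d)} (hp : p ∈ c.domain) :
    (disjointCopies k (completeBipartiteGraph (Fin d) (Fin d))).Adj p (c.toFun p) := by
  obtain ⟨i, x, hx, rfl⟩ := c.exists_of_mem_domain hp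
  rw [c.toFun_inl hx]
  exact ⟨rfl, by simp⟩

lemma toFun_notMem {p : Fin k × (Fin d ⊕ Fin d)} (hp : p ∈ c.domain) : c.toFun p ∉ c.domain := by
  obtain ⟨i, x, hx, rfl⟩ := c.exists_of_mem_domain hp
  rw [c.toFun_inl hx]
  rintro ⟨y, _, h⟩
  cases h

lemma injOn_toFun : Set.InjOn c.toFun c.domain := by
  intro p hp q hq h
  obtain ⟨i, x, hx, rfl⟩ := c.exists_of_mem_domain hp
  obtain ⟨j, y, hy, rfl⟩ := c.exists_of_mem_domain hq
  rw [c.toFun_inl hx, c.toFun_inl hy] at h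
  obtain ⟨rfl, h⟩ := Prod.mk.inj h
  have := (c i).2.injective (Sum.inr_injective h)
  rw [Subtype.mk.injEq] at this
  rw [this]

lemma ncard_domain : c.domain.ncard = ∑ i, a i := by
  have h : c.domain = (fun s : (i : Fin k) × Fin d => (s.1, (Sum.inl s.2 : Fin d ⊕ Fin d))) ''
      ((Finset.univ.sigma fun i => (c i).1.1 : Finset ((_ : Fin k) × Fin d)) :
        Set ((_ : Fin k) × Fin d)) := by
    ext p
    constructor
    · intro hp
      obtain ⟨i, x, hx, rfl⟩ := c.exists_of_mem_domain hp
      exact ⟨⟨i, x⟩, by simpa using hx, rfl⟩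
    · rintro ⟨⟨i, x⟩, hx, rfl⟩
      rw [mem_domain]
      simpa using hx
  rw [h, Set.ncard_image_of_injective, Set.ncard_coe_finset, Finset.card_sigma]
  · exact Finset.sum_congr rfl fun i _ => (c i).1.2
  · rintro ⟨i, x⟩ ⟨j, y⟩ h
    simpa using h

/-- The matching of the disjoint copies of `K_{d,d}` encoded by `c`. -/
def toSubgraph : (disjointCopies k (completeBipartiteGraph (Fin d) (Fin d))).Subgraph :=
  matchingSubgraph _ c.domain c.toFun fun _ => c.toFun_adj

lemma toSubgraph_adj {i : Fin k} {x y : Fin d} :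
    c.toSubgraph.Adj (i, Sum.inl x) (i, Sum.inr y) ↔
      ∃ h : x ∈ (c i).1.1, (c i).2 ⟨x, h⟩ = y := by
  constructor
  · rintro (⟨h, h'⟩ | ⟨⟨z, _, h⟩, _⟩)
    · have hx := c.mem_domain.1 h
      rw [c.toFun_inl hx] at h'
      exact ⟨hx, (Sum.inr_injective (Prod.mk.inj h').2).symm⟩
    · cases h
  · rintro ⟨h, rfl⟩
    exact Or.inl ⟨c.mem_domain.2 h, (c.toFun_inl h).symm⟩

/-- The chosen sets are recovered as the matched left vertices, the injections as their partners. -/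
lemma toSubgraph_injective : Function.Injective (toSubgraph (k := k) (d := d) (a := a)) := by
  intro c c' h
  have hadj : ∀ i x y, (∃ h : x ∈ (c i).1.1, (c i).2 ⟨x, h⟩ = y) ↔
      ∃ h : x ∈ (c' i).1.1, (c' i).2 ⟨x, h⟩ = y := fun i x y => by
    rw [← c.toSubgraph_adj, h, c'.toSubgraph_adj]
  funext i
  specialize hadj i
  generalize c i = s at hadj
  generalize c' i = s' at hadj
  obtain ⟨⟨A, hA⟩, f⟩ := s
  obtain ⟨⟨A', hA'⟩, f'⟩ := s'
  dsimp only at f f' hadj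
  have hAA : A = A' := by
    ext x
    exact ⟨fun hx => ((hadj x _).1 ⟨hx, rfl⟩).1, fun hx => ((hadj x _).2 ⟨hx, rfl⟩).1⟩
  subst hAA
  congr 1
  ext x
  obtain ⟨_, h2⟩ := (hadj x.1 _).1 ⟨x.2, rfl⟩
  exact congrArg Fin.val h2.symm

end PartialInjections

lemma prod_le_numMatchings_disjointCopies (k d : ℕ) (a : Fin k → ℕ) :
    ∏ i, d.choose (a i) * d.descFactorial (a i) ≤
      numMatchings (disjointCopies k (completeBipartiteGraph (Fin d) (Fin d))) (∑ i, a i) := by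
  rw [← card_partialInjections, ← Set.ncard_univ,
    ← Set.ncard_image_of_injective _ PartialInjections.toSubgraph_injective]
  refine Set.ncard_le_ncard ?_ (Set.toFinite _)
  rintro _ ⟨c, -, rfl⟩
  refine ⟨matchingSubgraph_isMatching _ c.injOn_toFun fun _ => c.toFun_notMem, ?_⟩
  rw [← c.ncard_domain]
  exact ncard_edgeSet_matchingSubgraph _ fun _ => c.toFun_notMem

/-! ### Even distribution of the edges and the lower bounds. -/

lemma exists_balanced_sum {k d ℓ : ℕ} (hk : 0 < k) (hℓ : ℓ ≤ d * k) :
    ∃ a : Fin k → ℕ, ∑ i, a i = ℓ ∧ ∀ i, a i ≤ d ∧ |(a i : ℝ) - ℓ / k| ≤ 1 := by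
  have hkR : (0 : ℝ) < k := by exact_mod_cast hk
  have hmod := Nat.div_add_mod ℓ k
  have hr := Nat.mod_lt ℓ hk
  refine ⟨fun i => ℓ / k + if (i : ℕ) < ℓ % k then 1 else 0, ?_, fun i => ⟨?_, ?_⟩⟩
  · rw [Finset.sum_add_distrib, Fin.sum_univ_eq_sum_range (fun i => if i < ℓ % k then 1 else 0),
      ← Finset.sum_filter]
    have : (Finset.range k).filter (fun i => i < ℓ % k) = Finset.range (ℓ % k) := by
      ext i
      simp only [Finset.mem_filter, Finset.mem_range]
      omega
    simp [this, hmod]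
  · have h1 : ℓ / k ≤ d := Nat.div_le_of_le_mul (by rwa [mul_comm])
    dsimp only
    split_ifs with h
    -- Rounding up occurs only when `ℓ % k > 0`, so `ℓ / k = d` would contradict `ℓ ≤ d * k`.
    · obtain h2 | h2 := h1.lt_or_eq
      · exact h2
      · rw [h2] at hmod
        have : d * k = k * d := mul_comm _ _
        omega
    · exact h1
  · have h1 : (ℓ : ℝ) / k = ((ℓ / k : ℕ) : ℝ) + ((ℓ % k : ℕ) : ℝ) / k := by
      rw [eq_comm, ← eq_sub_iff_add_eq', div_eq_iff hkR.ne', sub_mul, div_mul_cancel₀ _ hkR.ne']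
      have : (ℓ : ℝ) = k * ((ℓ / k : ℕ) : ℝ) + ((ℓ % k : ℕ) : ℝ) := by exact_mod_cast hmod.symm
      linarith
    have h2 : ((ℓ % k : ℕ) : ℝ) / k ≤ 1 :=
      div_le_one_of_le₀ (by exact_mod_cast hr.le) hkR.le
    have h3 : 0 ≤ ((ℓ % k : ℕ) : ℝ) / k := by positivity
    rw [h1, abs_le]
    dsimp only
    split_ifs <;> push_cast <;> constructor <;> linarith

theorem le_logb_numMatchings_copiesKdd {d N ℓ : ℕ} {α : ℝ} (hα0 : 0 < α) (hα1 : α < 1)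
    (hd : 2 ≤ d) (hdN : 2 * d ∣ N) (hN : 0 < N) (hα : 2 * (ℓ : ℝ) / (N : ℝ) = α) :
    (N : ℝ) / 2 * (α * Real.logb 2 d + 2 * binaryEntropy α
        + α * Real.logb 2 (α / Real.exp 1) - 30 * (Real.logb 2 d / d)) ≤
      Real.logb 2 (numMatchings (copiesKdd N d) ℓ) := by
  obtain ⟨k, rfl⟩ := hdN
  have hd0 : 0 < d := by omega
  have hk : 0 < k := Nat.pos_of_ne_zero (by
    rintro rfl
    simp at hN)
  have hdR : (0 : ℝ) < d := by exact_mod_cast hd0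
  have hkR : (0 : ℝ) < k := by exact_mod_cast hk
  have hℓ : (ℓ : ℝ) = α * (d * k) := by
    rw [← hα]
    push_cast
    field_simp
  have hℓle : ℓ ≤ d * k := by
    have : (ℓ : ℝ) ≤ ((d * k : ℕ) : ℝ) := by
      push_cast
      rw [hℓ]
      nlinarith [mul_pos hdR hkR]
    exact_mod_cast this
  obtain ⟨a, rfl, ha⟩ := exists_balanced_sum hk hℓle
  have hα' : ((∑ i, a i : ℕ) : ℝ) / k = α * d := by
    rw [hℓ]
    field_simp
  have hcount := prod_le_numMatchings_disjointCopies k d a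
  rw [copiesKdd, Nat.mul_div_cancel_left _ (by positivity)]
  set m := numMatchings (disjointCopies k (completeBipartiteGraph (Fin d) (Fin d))) (∑ i, a i)
  have hpos : ∀ i, 0 < d.choose (a i) * d.descFactorial (a i) := fun i =>
    Nat.mul_pos (Nat.choose_pos (ha i).1) (Nat.descFactorial_pos.2 (ha i).1)
  have hlog : (k : ℝ) * (d * (α * Real.log d - α * Real.log α
      - 2 * ((1 - α) * Real.log (1 - α)) - α) - 30 * Real.log d) ≤ Real.log m := by
    calc _ = ∑ _i : Fin k, (d * (α * Real.log d - α * Real.log α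
          - 2 * ((1 - α) * Real.log (1 - α)) - α) - 30 * Real.log d) := by
          rw [Finset.sum_const, Finset.card_univ, Fintype.card_fin, nsmul_eq_mul]
      _ ≤ ∑ i, Real.log ((d.choose (a i) * d.descFactorial (a i) : ℕ) : ℝ) :=
          Finset.sum_le_sum fun i _ =>
            le_log_choose_mul_descFactorial hd (ha i).1 hα0 hα1 (hα' ▸ (ha i).2)
      _ = Real.log ((∏ i, d.choose (a i) * d.descFactorial (a i) : ℕ) : ℝ) := by
          rw [Nat.cast_prod, Real.log_prod]
          exact fun i _ => Nat.cast_ne_zero.2 (hpos i).ne'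
      _ ≤ Real.log m := Real.log_le_log
          (Nat.cast_pos.2 (Finset.prod_pos fun i _ => hpos i)) (by exact_mod_cast hcount)
  have hL : 0 < Real.log 2 := Real.log_pos one_lt_two
  -- Since `N / 2 = d * k`, an error `30 log d` per copy becomes `30 log d / d` inside the bracket.
  refine le_trans (le_of_eq ?_) (div_le_div_of_nonneg_right hlog hL.le)
  rw [binaryEntropy_eq, Real.logb, Real.logb, Real.log_div hα0.ne' (Real.exp_pos 1).ne',
    Real.log_exp]
  push_cast
  field_simp
  ring

theorem one_sub_mul_le_logb_numMatchings_copiesKdd {α : ℝ} (hα0 : 0 < α) (hα1 : α < 1)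
    {ε : ℝ} (hε : 0 < ε) :
    ∃ d₀ : ℕ, ∀ d N ℓ : ℕ, d₀ ≤ d → 2 * d ∣ N → 0 < N → 2 * (ℓ : ℝ) / (N : ℝ) = α →
      (1 - ε) * ((N : ℝ) / 2 * (α * Real.logb 2 d + binaryEntropy α)) ≤
        Real.logb 2 (numMatchings (copiesKdd N d) ℓ) := by
  have hlim : Filter.Tendsto (fun d : ℕ => ε * α * Real.logb 2 d) Filter.atTop Filter.atTop :=
    ((Real.tendsto_logb_atTop one_lt_two).comp tendsto_natCast_atTop_atTop).const_mul_atTop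
      (mul_pos hε hα0)
  -- Beyond this threshold `ε α log d` outweighs the error, at most 30 because `log d ≤ d`, and the
  -- term `α log (α / e)`; the surplus entropy is nonnegative.
  obtain ⟨d₁, hd₁⟩ := (Filter.eventually_atTop.1
    (hlim.eventually_ge_atTop (30 - α * Real.logb 2 (α / Real.exp 1))))
  refine ⟨max 2 d₁, fun d N ℓ hd hdN hN hα => ?_⟩
  have hd2 : 2 ≤ d := (le_max_left _ _).trans hd
  have h1 := hd₁ d ((le_max_right _ _).trans hd)
  refine le_trans ?_ (le_logb_numMatchings_copiesKdd hα0 hα1 hd2 hdN hN hα)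
  rw [mul_left_comm]
  refine mul_le_mul_of_nonneg_left ?_ (by positivity)
  have h2 : Real.logb 2 d / d ≤ 1 := by
    refine div_le_one_of_le₀ ?_ d.cast_nonneg
    rw [Real.logb_le_iff_le_rpow one_lt_two (by positivity), Real.rpow_natCast]
    exact_mod_cast Nat.lt_two_pow_self.le
  have h3 := mul_nonneg hε.le (binaryEntropy_nonneg hα0.le hα1.le)
  have h4 := binaryEntropy_nonneg hα0.le hα1.le
  linarith

theorem mainTheorem1 :
    -- the upper bound, for every `d`-regular graph
    (∀ (V : Type*) [Fintype V] (G : SimpleGraph V) [DecidableRel G.Adj] (d N ℓ : ℕ) (α : ℝ),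
      G.IsRegularOfDegree d → Fintype.card V = N → 2 * ℓ ≤ N → α = 2 * (ℓ : ℝ) / (N : ℝ) →
        Real.logb 2 (numMatchings G ℓ) ≤
          (N : ℝ) / 2 * (α * Real.logb 2 d + binaryEntropy α)) ∧
    -- the lower bound for disjoint copies of `K_{d,d}`; `C` depends on `α` only
    (∀ α : ℝ, 0 < α → α < 1 → ∃ C : ℝ, 0 < C ∧
      ∀ d N ℓ : ℕ, 2 ≤ d → 2 * d ∣ N → 0 < N → 2 * (ℓ : ℝ) / (N : ℝ) = α →
        (N : ℝ) / 2 * (α * Real.logb 2 d + 2 * binaryEntropy α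
            + α * Real.logb 2 (α / Real.exp 1) - C * (Real.logb 2 d / d)) ≤
          Real.logb 2 (numMatchings (copiesKdd N d) ℓ)) ∧
    -- the upper bound is attained by these graphs up to a factor tending to `1` as `d → ∞`
    (∀ α : ℝ, 0 < α → α < 1 → ∀ ε : ℝ, 0 < ε → ∃ d₀ : ℕ,
      ∀ d N ℓ : ℕ, d₀ ≤ d → 2 * d ∣ N → 0 < N → 2 * (ℓ : ℝ) / (N : ℝ) = α →
        (1 - ε) * ((N : ℝ) / 2 * (α * Real.logb 2 d + binaryEntropy α)) ≤
          Real.logb 2 (numMatchings (copiesKdd N d) ℓ)) := by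
  refine ⟨fun V _ G _ d N ℓ α hG hN hℓ hα => logb_numMatchings_le G hG hN hℓ hα,
    fun α hα0 hα1 => ⟨30, by norm_num, fun d N ℓ hd hdN hN hα =>
      le_logb_numMatchings_copiesKdd hα0 hα1 hd hdN hN hα⟩,
    fun α hα0 hα1 ε hε => one_sub_mul_le_logb_numMatchings_copiesKdd hα0 hα1 hε⟩
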